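/- Consider a data re-uploading quantum neural network on $N$ qubits with $L\ge 1$ layers for data $\bm x\in\mathbb R^D$, $D\ge1$. Its circuit is the unitary $$U(\bm\theta,\bm x)=W_L(\bm\theta^{(L)})\,E(\bm x)\,W_{L-1}(\bm\theta^{(L-1)})\cdots W_1(\bm\theta^{(1)})\,E(\bm x)\,W_0(\bm\theta^{(0)}),$$ where $E(\bm x)$ is a (measurable) data-encoding unitary and each trainable block $W_l$ is an ordered product of arbitrary fixed unitaries and single-qubit Pauli rotations $e^{-i\theta P/2}$, $P\in\{X,Y,Z\}$, one for each of its trainable parameters; $K$ is the total number of trainable parameters. With an input density matrix $\rho_{in}$ and a Hermitian observable $\mathcal M$ of operator norm $\|\mathcal M\|_\infty$, the output is $f(\bm\theta,\bm x)=\mathrm{tr}[\mathcal M\,U(\bm\theta,\bm x)\rho_{in}U(\bm\theta,\bm x)^\dagger]$. Let $\ell(a,y)$ be a loss function (of the prediction $a$ and the label $y$) such that, for every label $y$ that occurs, on an interval containing all outputs of the network, $a\mapsto\ell(a,y)$ is $\mathcal C_1$-Lipschitz, differentiable with $\mathcal C_2$-Lipschitz derivative, and $0\le\ell\le M$. Let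 $S=\{(\bm x_i,y_i)\}_{i=1}^m$, $m\ge1$, be drawn i.i.d. from a probability distribution $\mathbb D$ on $\mathbb R^D\times\mathbb R$, and let $\mathcal A_S$ be the network with the parameters obtained from a fixed initial parameter vector by $T$ steps of stochastic gradient descent $\theta^{(j)}\leftarrow\theta^{(j)}-\eta\,\partial_{\theta^{(j)}}\ell(f(\bm\theta,\bm x_i),y_i)$, $j=1,\dots,K$, with learning rate $\eta>0$, the index $i$ being chosen uniformly at random and independently at each step. Let $R(\mathcal A_S)=\mathbb E_{(\bm x,y)\sim\mathbb D}[\ell(f_{\mathcal A_S}(\bm x),y)]$ and $\hat R(\mathcal A_S)=\frac1m\sum_{i=1}^m\ell(f_{\mathcal A_S}(\bm x_i),y_i)$, and let $\mathbb E_{\mathrm{SGD}}$ be the expectation over the random indices. Then for every $\delta\in(0,1)$, with probability at least $1-\delta$ over the draw of $S$, $$\mathbb E_{\mathrm{SGD}}[R(\mathcal A_S)-\hat R(\mathcal A_S)]\le\frac{LD\|\mathcal M\|_\infty}{m}\,g_T(\eta K\|\mathcal M\|_\infty)+\Big(LD\|\mathcal M\|_\infty\, g_T(\eta K\|\mathcal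 M\|_\infty)+M\Big)\sqrt{\frac{\log\frac1\delta}{2m}},$$ where the functions $g_T:\mathbb R\to\mathbb R$ depend only on $\mathcal C_1$ and $\mathcal C_2$, and $g_T(u)=\mathcal O(u^{T})$ as $u\to\infty$, uniformly in $T\in\{0,1,2,\dots\}$ (that is, there are $C,u_0$ depending only on $\mathcal C_1,\mathcal C_2$ with $|g_T(u)|\le C u^T$ for all $T$ and all $u\ge u_0$). -/

import Mathlib

open MeasureTheory Filter Asymptotics
open scoped NNReal ENNReal ComplexOrder

noncomputable section

namespace QNN

/-- Index set of the computational basis of `N` qubits (it has `2 ^ N` elements). -/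
abbrev Basis (N : ℕ) : Type := Fin N → Fin 2

/-- Operators on the Hilbert space of `N` qubits. -/
abbrev Op (N : ℕ) : Type := Matrix (Basis N) (Basis N) ℂ

/-- The Schatten-`∞` norm, that is, the operator norm on the Hilbert space `ℂ ^ (2 ^ N)`. -/
def opNorm {N : ℕ} (A : Op N) : ℝ :=
  ‖Matrix.toEuclideanCLM (n := Basis N) (𝕜 := ℂ) A‖

/-- Labels of the three Pauli matrices. -/
inductive Pauli : Type where
  | X : Pauli
  | Y : Pauli
  | Z : Pauli

/-- The Pauli matrices. -/
def Pauli.toMatrix : Pauli → Matrix (Fin 2) (Fin 2) ℂ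
  | Pauli.X => !![0, 1; 1, 0]
  | Pauli.Y => !![0, -Complex.I; Complex.I, 0]
  | Pauli.Z => !![1, 0; 0, -1]

/-- The Pauli matrix `P` on qubit `q`, tensored with the identity on all other qubits. -/
def pauliOn {N : ℕ} (q : Fin N) (P : Pauli) : Op N :=
  Matrix.of fun a b =>
    ∏ k : Fin N, (if k = q then P.toMatrix else 1 : Matrix (Fin 2) (Fin 2) ℂ) (a k) (b k)

/-- The rotation gate `exp (-i α P / 2)` on qubit `q`. -/
def rotation {N : ℕ} (q : Fin N) (P : Pauli) (α : ℝ) : Op N :=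
  NormedSpace.exp ((-(Complex.I * (α : ℂ) / 2)) • pauliOn q P)

/-- A trainable block with `n` parameters on `N` qubits: single-qubit Pauli rotations, one for
each parameter, interleaved with fixed unitary gates. -/
structure TrainableBlock (N n : ℕ) where
  /-- the fixed gate standing to the left of the `k`-th rotation -/
  gate : Fin n → Matrix.unitaryGroup (Basis N) ℂ
  /-- the fixed gate standing to the right of all rotations -/
  last : Matrix.unitaryGroup (Basis N) ℂ
  /-- the qubit on which the `k`-th rotation acts -/
  qubit : Fin n → Fin N
  /-- the Pauli matrix generating the `k`-th rotation -/
  axis : Fin n → Pauli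

/-- The unitary `(∏ k, U_k exp (-i α_k P_k / 2)) V` of a trainable block (ordered product). -/
def TrainableBlock.toOp {N n : ℕ} (W : TrainableBlock N n) (α : Fin n → ℝ) : Op N :=
  (List.ofFn fun k : Fin n =>
    (W.gate k : Op N) * rotation (W.qubit k) (W.axis k) (α k)).prod * (W.last : Op N)

/-- An `L`-layer data re-uploading quantum neural network on `N` qubits, for data in `ℝ ^ D`.
The `L + 1` trainable blocks, the `l`-th one with `n l` parameters, are interspersed with `L`
uploads of the data by the same encoding unitary. -/
structure ReuploadingQNN (N L D : ℕ) (n : Fin (L + 1) → ℕ) where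
  /-- the input state, a density matrix -/
  rho : Op N
  rho_posSemidef : rho.PosSemidef
  rho_trace : rho.trace = 1
  /-- the trainable blocks, in the order in which they act -/
  block : (l : Fin (L + 1)) → TrainableBlock N (n l)
  /-- the data-encoding unitary -/
  encode : (Fin D → ℝ) → Matrix.unitaryGroup (Basis N) ℂ
  encode_measurable : ∀ a b : Basis N, Measurable fun x => (encode x : Op N) a b
  /-- the measured observable -/
  obs : Op N
  obs_hermitian : obs.IsHermitian

/-- Parameter vectors: one real number for every rotation of every block. -/
abbrev Params {L : ℕ} (n : Fin (L + 1) → ℕ) : Type := (Σ l : Fin (L + 1), Fin (n l)) → ℝ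

/-- The number `K` of trainable parameters. -/
def numParams {L : ℕ} (n : Fin (L + 1) → ℕ) : ℕ := ∑ l, n l

namespace ReuploadingQNN

variable {N L D : ℕ} {n : Fin (L + 1) → ℕ}

/-- The unitary of the `l`-th trainable block, evaluated at its share of the parameters. -/
def blockOp (Q : ReuploadingQNN N L D n) (θ : Params n) (l : Fin (L + 1)) : Op N :=
  (Q.block l).toOp fun k => θ ⟨l, k⟩

/-- The unitary `W_L E(x) W_{L-1} E(x) ⋯ W_1 E(x) W_0` of the whole circuit. -/
def circuit (Q : ReuploadingQNN N L D n) (θ : Params n) (x : Fin D → ℝ) : Op N :=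
  (List.ofFn fun l : Fin L => Q.blockOp θ l.succ * (Q.encode x : Op N)).reverse.prod
    * Q.blockOp θ 0

/-- The output `tr (ℳ U ρ U†)` of the network. It is real because the observable is Hermitian. -/
def output (Q : ReuploadingQNN N L D n) (θ : Params n) (x : Fin D → ℝ) : ℝ :=
  (Q.obs * (Q.circuit θ x * Q.rho * (Q.circuit θ x).conjTranspose)).trace.re

/-- The loss `ℓ (f (θ, x), y)` at the example `z = (x, y)`. -/
def lossAt (Q : ReuploadingQNN N L D n) (ℓ : ℝ → ℝ → ℝ) (θ : Params n)
    (z : (Fin D → ℝ) × ℝ) : ℝ :=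
  ℓ (Q.output θ z.1) z.2

/-- One gradient step with learning rate `η` on the example `z`. -/
def sgdStep (Q : ReuploadingQNN N L D n) (ℓ : ℝ → ℝ → ℝ) (η : ℝ) (θ : Params n)
    (z : (Fin D → ℝ) × ℝ) : Params n :=
  fun j => θ j - η * deriv (fun s : ℝ => Q.lossAt ℓ (Function.update θ j s) z) (θ j)

/-- The parameters after `T` steps started at `θ₀`, when the `t`-th step uses the training
example number `σ t`. -/
def sgdRun (Q : ReuploadingQNN N L D n) (ℓ : ℝ → ℝ → ℝ) (η : ℝ) (θ₀ : Params n)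
    {m T : ℕ} (S : Fin m → (Fin D → ℝ) × ℝ) (σ : Fin T → Fin m) : Params n :=
  (List.ofFn σ).foldl (fun θ i => Q.sgdStep ℓ η θ (S i)) θ₀

/-- The expected risk. -/
def risk (Q : ReuploadingQNN N L D n) (ℓ : ℝ → ℝ → ℝ) (P : Measure ((Fin D → ℝ) × ℝ))
    (θ : Params n) : ℝ :=
  ∫ z, Q.lossAt ℓ θ z ∂P

/-- The empirical risk on the training set `S`. -/
def empiricalRisk (Q : ReuploadingQNN N L D n) (ℓ : ℝ → ℝ → ℝ) {m : ℕ}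
    (S : Fin m → (Fin D → ℝ) × ℝ) (θ : Params n) : ℝ :=
  (∑ i, Q.lossAt ℓ θ (S i)) / (m : ℝ)

/-- The generalization gap after `T` steps of stochastic gradient descent on `S`, in expectation
over the `T` independent uniformly random choices of a training example. -/
def expectedGap (Q : ReuploadingQNN N L D n) (ℓ : ℝ → ℝ → ℝ) (P : Measure ((Fin D → ℝ) × ℝ))
    (η : ℝ) (T : ℕ) (θ₀ : Params n) {m : ℕ} (S : Fin m → (Fin D → ℝ) × ℝ) : ℝ :=
  (∑ σ : Fin T → Fin m,
    (Q.risk ℓ P (Q.sgdRun ℓ η θ₀ S σ) - Q.empiricalRisk ℓ S (Q.sgdRun ℓ η θ₀ S σ)))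
      / (m : ℝ) ^ T

end ReuploadingQNN

/-- The loss `ℓ (prediction, label)`, for predictions in the interval `I` and labels in `Y`, is
`C₁`-Lipschitz and `C₂`-smooth in the prediction and takes values in `[0, B]`. The choice
`I = Y = Set.univ` requires this for all predictions and all labels. -/
structure LipschitzSmoothBounded (ℓ : ℝ → ℝ → ℝ) (I Y : Set ℝ) (C₁ C₂ : ℝ≥0) (B : ℝ) :
    Prop where
  lipschitz : ∀ y ∈ Y, LipschitzOnWith C₁ (fun a => ℓ a y) I
  differentiable : ∀ y ∈ Y, DifferentiableOn ℝ (fun a => ℓ a y) I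
  smooth : ∀ y ∈ Y, LipschitzOnWith C₂ (derivWithin (fun a => ℓ a y) I) I
  bounded : ∀ y ∈ Y, ∀ a ∈ I, 0 ≤ ℓ a y ∧ ℓ a y ≤ B

end QNN

end

/-! The bound follows from uniform stability, without estimating gradients. If a run of `T` steps
never draws example `i`, replacing that example leaves the run unchanged; the chance of drawing it
is at most `T / m`. When it is drawn, the crudest estimate suffices: outputs lie in `[-‖ℳ‖, ‖ℳ‖]`
(`abs_output_le`), so by the Lipschitz property two losses at the same point differ by at most `B =
2 * C₁ * ‖ℳ‖`. Hence the mean loss is stable with constant `T * B / m`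
(`abs_meanRun_update_sub_le`).

Stability is then converted to generalization. Exchanging a training point with a fresh one bounds
the mean gap by `T * B / m` (`integral_meanGap_le`). Replacing one example moves the gap by at most
`(2 * T * B + M) / m`, so McDiarmid's inequality (`measureReal_ge_le_of_boundedDifferences`)
controls its fluctuations.

The resulting rate is linear in `T` and constant in `u`. Since `T ≤ 2 ^ T ≤ u ^ T` for `u ≥ 2`, it
is `O(u ^ T)` uniformly in `T`; the factor `L * D ≥ 1` only weakens the bound. -/

namespace QNN

/-! ### Concentration for functions of i.i.d. samples -/

section BoundedDifferences

variable {Z : Type*} [MeasurableSpace Z] {P : Measure Z} [IsProbabilityMeasure P]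

/-- One-coordinate Hoeffding lemma, for a function whose oscillation is at most `c`. -/
theorem integral_exp_le_of_oscillation {φ : Z → ℝ} (hφ : Measurable φ) {c : ℝ≥0}
    (hc : ∀ z z', |φ z - φ z'| ≤ c) (t : ℝ) :
    ∫ z, Real.exp (t * φ z) ∂P
      ≤ Real.exp (t * ∫ z, φ z ∂P) * Real.exp ((c / 2) ^ 2 * t ^ 2 / 2) := by
  have hne : Nonempty Z := P.nonempty_of_neZero
  obtain ⟨z₀⟩ := hne
  have hbdd : BddBelow (Set.range φ) :=
    ⟨φ z₀ - c, by rintro _ ⟨z, rfl⟩; linarith [abs_le.1 (hc z z₀)]⟩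
  -- The range fits in an interval of length `c` starting at the infimum, so Hoeffding's lemma gives
  -- variance proxy `(c / 2) ^ 2`.
  have hmem : ∀ z, φ z ∈ Set.Icc (⨅ z, φ z) ((⨅ z, φ z) + c) := fun z => by
    refine ⟨ciInf_le hbdd z, ?_⟩
    have : φ z - c ≤ ⨅ z, φ z :=
      haveI : Nonempty Z := ⟨z₀⟩
      le_ciInf fun z' => by linarith [abs_le.1 (hc z z')]
    linarith
  have h := (ProbabilityTheory.hasSubgaussianMGF_of_mem_Icc (μ := P) hφ.aemeasurable
    (Eventually.of_forall hmem)).mgf_le t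
  have hn : (‖(⨅ z, φ z) + c - ⨅ z, φ z‖₊ : ℝ≥0) = c := by
    rw [add_sub_cancel_left]; ext; simp
  rw [hn] at h
  simp only [ProbabilityTheory.mgf, mul_sub, Real.exp_sub] at h
  rw [integral_div, div_le_iff₀ (Real.exp_pos _)] at h
  refine h.trans (le_of_eq ?_)
  push_cast
  ring

theorem integral_pi_succ {m : ℕ} (Φ : (Fin (m + 1) → Z) → ℝ)
    (hΦ : Integrable Φ (Measure.pi fun _ => P)) :
    ∫ S, Φ S ∂(Measure.pi fun _ : Fin (m + 1) => P)
      = ∫ S, ∫ z, Φ (Fin.cons z S) ∂P ∂(Measure.pi fun _ : Fin m => P) := by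
  have e := (measurePreserving_piFinSuccAbove (fun _ : Fin (m + 1) => P) 0).symm
  have hi : Integrable (fun p : Z × (Fin m → Z) => Φ (Fin.cons p.1 p.2))
      (P.prod (Measure.pi fun _ : Fin m => P)) := by
    have := (e.integrable_comp_emb (MeasurableEquiv.measurableEmbedding _)).2 hΦ
    refine this.congr (Eventually.of_forall fun p => ?_)
    simp [Fin.insertNthEquiv]
  rw [← integral_prod_symm _ hi, ← e.integral_comp']
  refine integral_congr_ae (Eventually.of_forall fun p => ?_)
  simp [Fin.insertNthEquiv]

/-- Induction on the number of coordinates. Hoeffding's lemma, applied to coordinate `0` with the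
others frozen, costs one factor `exp ((c / 2) ^ 2 * t ^ 2 / 2)` and leaves the average over that
coordinate, which inherits the bounded differences. The bound `C` serves integrability only. -/
theorem integral_exp_le_of_boundedDifferences {c : ℝ≥0} (t : ℝ) {m : ℕ}
    {Φ : (Fin m → Z) → ℝ} (hΦ : Measurable Φ) {C : ℝ} (hC : ∀ S, |Φ S| ≤ C)
    (hc : ∀ S i z, |Φ (Function.update S i z) - Φ S| ≤ c) :
    ∫ S, Real.exp (t * Φ S) ∂(Measure.pi fun _ : Fin m => P)
      ≤ Real.exp (t * ∫ S, Φ S ∂(Measure.pi fun _ : Fin m => P))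
        * Real.exp (m * (c / 2) ^ 2 * t ^ 2 / 2) := by
  have hbd : ∀ x : ℝ, |x| ≤ C → |Real.exp (t * x)| ≤ Real.exp (|t| * C) := fun x hx => by
    rw [Real.abs_exp]
    refine Real.exp_le_exp.2 ((le_abs_self _).trans ?_)
    rw [abs_mul]; gcongr
  induction m with
  | zero =>
    have h0 : ∀ S : Fin 0 → Z, S = default := fun S => Subsingleton.elim _ _
    have : ∀ S, Φ S = Φ default := fun S => by rw [h0 S]
    simp [this]
  | succ m ih =>
    have hcons : Measurable fun p : (Fin m → Z) × Z => (Fin.cons p.2 p.1 : Fin (m + 1) → Z) := by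
      refine measurable_pi_lambda _ fun i => ?_
      refine Fin.cases ?_ (fun j => ?_) i
      · simpa using measurable_snd
      · have : Measurable fun p : (Fin m → Z) × Z => p.1 j :=
          (measurable_pi_apply j).comp measurable_fst
        simpa using this
    have hΨ : Measurable fun p : (Fin m → Z) × Z => Φ (Fin.cons p.2 p.1) := hΦ.comp hcons
    set Φ' : (Fin m → Z) → ℝ := fun S => ∫ z, Φ (Fin.cons z S) ∂P with hΦ'
    have hsec : ∀ S : Fin m → Z, Measurable fun z => Φ (Fin.cons z S) := fun S =>
      hΨ.comp (measurable_const.prodMk measurable_id)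
    have hseci : ∀ S : Fin m → Z, Integrable (fun z => Φ (Fin.cons z S)) P := fun S =>
      .of_bound (hsec S).aestronglyMeasurable C (Eventually.of_forall fun z => hC _)
    have hm' : Measurable Φ' := hΨ.stronglyMeasurable.integral_prod_right'.measurable
    have hC' : ∀ S, |Φ' S| ≤ C := fun S => by
      have := norm_integral_le_of_norm_le_const (μ := P)
        (f := fun z => Φ (Fin.cons z S)) (Eventually.of_forall fun z => hC (Fin.cons z S))
      simpa using this
    have hc' : ∀ S i z, |Φ' (Function.update S i z) - Φ' S| ≤ c := fun S i z => by
      rw [hΦ', ← integral_sub (hseci _) (hseci _)]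
      have := norm_integral_le_of_norm_le_const (μ := P)
        (f := fun x => Φ (Fin.cons x (Function.update S i z)) - Φ (Fin.cons x S)) (C := c)
        (Eventually.of_forall fun x => by
          rw [Fin.cons_update]; exact hc _ _ _)
      simpa using this
    have hexpm : Measurable fun p : (Fin m → Z) × Z => Real.exp (t * Φ (Fin.cons p.2 p.1)) :=
      (hΨ.const_mul t).exp
    calc ∫ S, Real.exp (t * Φ S) ∂(Measure.pi fun _ : Fin (m + 1) => P)
        = ∫ S, ∫ z, Real.exp (t * Φ (Fin.cons z S)) ∂P ∂(Measure.pi fun _ : Fin m => P) :=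
          integral_pi_succ _ (.of_bound (hΦ.const_mul t).exp.aestronglyMeasurable _
            (Eventually.of_forall fun S => hbd _ (hC S)))
      _ ≤ ∫ S, Real.exp (t * Φ' S) * Real.exp ((c / 2) ^ 2 * t ^ 2 / 2)
            ∂(Measure.pi fun _ : Fin m => P) := by
          refine integral_mono (.of_bound (C := Real.exp (|t| * C))
            hexpm.stronglyMeasurable.integral_prod_right'.measurable.aestronglyMeasurable
            (Eventually.of_forall fun S => ?_))
            ((Integrable.of_bound (hm'.const_mul t).exp.aestronglyMeasurable _
              (Eventually.of_forall fun S => hbd _ (hC' S))).mul_const _) fun S => ?_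
          · have := norm_integral_le_of_norm_le_const (μ := P)
              (f := fun z => Real.exp (t * Φ (Fin.cons z S)))
              (Eventually.of_forall fun z => hbd _ (hC (Fin.cons z S)))
            simpa using this
          · refine integral_exp_le_of_oscillation (hsec S) (fun z z' => ?_) t
            simpa using hc (Fin.cons z' S) 0 z
      _ = (∫ S, Real.exp (t * Φ' S) ∂(Measure.pi fun _ : Fin m => P))
            * Real.exp ((c / 2) ^ 2 * t ^ 2 / 2) := integral_mul_const _ _
      _ ≤ (Real.exp (t * ∫ S, Φ' S ∂(Measure.pi fun _ : Fin m => P))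
            * Real.exp (m * (c / 2) ^ 2 * t ^ 2 / 2)) * Real.exp ((c / 2) ^ 2 * t ^ 2 / 2) := by
          gcongr
          exact ih hm' hC' hc'
      _ = _ := by
          rw [integral_pi_succ Φ (.of_bound hΦ.aestronglyMeasurable C (Eventually.of_forall hC)),
            mul_assoc, ← Real.exp_add]
          congr 2
          push_cast
          ring

/-- **McDiarmid's bounded differences inequality** for i.i.d. samples. -/
theorem measureReal_ge_le_of_boundedDifferences {c : ℝ≥0} {m : ℕ}
    {Φ : (Fin m → Z) → ℝ} (hΦ : Measurable Φ) {C : ℝ} (hC : ∀ S, |Φ S| ≤ C)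
    (hc : ∀ S i z, |Φ (Function.update S i z) - Φ S| ≤ c) {ε : ℝ} (hε : 0 ≤ ε) :
    (Measure.pi fun _ : Fin m => P).real
        {S | ε ≤ Φ S - ∫ S, Φ S ∂(Measure.pi fun _ : Fin m => P)}
      ≤ Real.exp (-ε ^ 2 / (2 * (m * (c / 2) ^ 2))) := by
  have h : ProbabilityTheory.HasSubgaussianMGF
      (fun S => Φ S - ∫ S, Φ S ∂(Measure.pi fun _ : Fin m => P)) (m * (c / 2) ^ 2)
      (Measure.pi fun _ : Fin m => P) := by
    refine ⟨fun t => ?_, fun t => ?_⟩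
    · refine .of_bound ((hΦ.sub_const _).const_mul t).exp.aestronglyMeasurable
        (Real.exp (|t| * (C + |∫ S, Φ S ∂(Measure.pi fun _ : Fin m => P)|)))
        (Eventually.of_forall fun S => ?_)
      rw [Real.norm_eq_abs, Real.abs_exp]
      refine Real.exp_le_exp.2 ((le_abs_self _).trans ?_)
      rw [abs_mul]
      gcongr
      exact (abs_sub _ _).trans (by gcongr; exact hC S)
    · simp only [ProbabilityTheory.mgf, mul_sub, Real.exp_sub]
      rw [integral_div, div_le_iff₀ (Real.exp_pos _)]
      refine (integral_exp_le_of_boundedDifferences t hΦ hC hc).trans (le_of_eq ?_)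
      push_cast
      ring
  simpa using h.measure_ge_le hε

/-- Resampling one coordinate of an i.i.d. sample does not change its law. -/
theorem measurePreserving_update {m : ℕ} (i : Fin m) :
    MeasurePreserving (fun p : (Fin m → Z) × Z => Function.update p.1 i p.2)
      ((Measure.pi fun _ : Fin m => P).prod P) (Measure.pi fun _ : Fin m => P) := by
  have hmeas : Measurable fun p : (Fin m → Z) × Z => Function.update p.1 i p.2 := by
    refine measurable_pi_lambda _ fun j => ?_
    by_cases h : j = i
    · subst h; simpa using measurable_snd
    · have : Measurable fun p : (Fin m → Z) × Z => p.1 j :=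
        (measurable_pi_apply j).comp measurable_fst
      simpa [h] using this
  refine ⟨hmeas, (Measure.pi_eq fun s hs => ?_).symm⟩
  rw [Measure.map_apply hmeas (MeasurableSet.univ_pi hs)]
  -- The preimage of a box is again a box: side `i` becomes free and its constraint passes to the
  -- fresh coordinate.
  have : (fun p : (Fin m → Z) × Z => Function.update p.1 i p.2) ⁻¹' (Set.univ.pi s)
      = (Set.univ.pi (Function.update s i Set.univ)) ×ˢ s i := by
    ext p
    simp only [Set.mem_preimage, Set.mem_univ_pi, Set.mem_prod]
    refine ⟨fun h => ⟨fun j => ?_, by simpa using h i⟩, fun h j => ?_⟩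
    · by_cases hj : j = i
      · subst hj; simp
      · simpa [hj] using h j
    · by_cases hj : j = i
      · subst hj; simpa using h.2
      · simpa [hj] using h.1 j
  rw [this, Measure.prod_prod, Measure.pi_pi]
  rw [← Finset.mul_prod_erase _ _ (Finset.mem_univ i),
    ← Finset.mul_prod_erase _ (fun j => P (s j)) (Finset.mem_univ i)]
  have he : ∏ x ∈ Finset.univ.erase i, P (Function.update s i Set.univ x)
      = ∏ x ∈ Finset.univ.erase i, P (s x) :=
    Finset.prod_congr rfl fun j hj => by rw [Function.update_of_ne (Finset.ne_of_mem_erase hj)]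
  rw [he]
  simp [mul_comm]

end BoundedDifferences

end QNN

noncomputable section

namespace QNN

/-! ### Stability of random iterations and generalization -/

section Stability

variable {Z Θ : Type*}

/-- The state reached from `θ₀` by updating along the training examples with indices `σ`. -/
def iterRun (G : Θ → Z → Θ) (θ₀ : Θ) {m T : ℕ} (S : Fin m → Z) (σ : Fin T → Fin m) : Θ :=
  (List.ofFn σ).foldl (fun θ i => G θ (S i)) θ₀

/-- The expectation of `h` over the random choice of the training examples. -/
def meanRun (G : Θ → Z → Θ) (θ₀ : Θ) (T : ℕ) {m : ℕ} (S : Fin m → Z) (h : Θ → ℝ) : ℝ :=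
  (∑ σ : Fin T → Fin m, h (iterRun G θ₀ S σ)) / (m : ℝ) ^ T

variable {G : Θ → Z → Θ} {θ₀ : Θ} {T m : ℕ}

theorem iterRun_update {S : Fin m → Z} {σ : Fin T → Fin m} {i : Fin m} (z : Z)
    (h : ∀ t, σ t ≠ i) : iterRun G θ₀ (Function.update S i z) σ = iterRun G θ₀ S σ := by
  refine List.foldl_ext _ _ _ fun θ k hk => ?_
  obtain ⟨t, rfl⟩ := (List.mem_ofFn' _ _).1 hk
  rw [Function.update_of_ne (h t)]

/-- By Bernoulli's inequality, a fixed example is visited within `T` steps with probability at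
most `T / m`. -/
theorem card_visit_le (i : Fin m) :
    ((Finset.univ.filter fun σ : Fin T → Fin m => ∃ t, σ t = i).card : ℝ)
      ≤ T / m * (m : ℝ) ^ T := by
  have hm : 0 < m := i.pos
  have hm' : (0 : ℝ) < m := by exact_mod_cast hm
  -- The sequences avoiding `i` number `(m - 1) ^ T`, which Bernoulli's inequality bounds below by
  -- `(1 - T / m) * m ^ T`.
  have hcompl : (Finset.univ.filter fun σ : Fin T → Fin m => ¬ ∃ t, σ t = i)
      = Fintype.piFinset fun _ => Finset.univ.erase i := by
    ext σ; simp
  have hsum := Finset.card_filter_add_card_filter_not (s := (Finset.univ : Finset (Fin T → Fin m)))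
    (fun σ => ∃ t, σ t = i)
  rw [hcompl, Fintype.card_piFinset_const, Finset.card_erase_of_mem (Finset.mem_univ i)] at hsum
  simp only [Finset.card_univ, Fintype.card_fin, Fintype.card_pi, Finset.prod_const] at hsum
  have hsum' : ((Finset.univ.filter fun σ : Fin T → Fin m => ∃ t, σ t = i).card : ℝ)
      + ((m : ℝ) - 1) ^ T = (m : ℝ) ^ T := by
    have := congrArg (Nat.cast : ℕ → ℝ) hsum
    push_cast [Nat.cast_sub (Nat.one_le_iff_ne_zero.2 hm.ne')] at this
    exact this
  have hb := one_add_mul_le_pow (a := -(1 / m : ℝ)) (by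
    have : (1 : ℝ) / m ≤ 1 := by
      rw [div_le_one hm']; exact_mod_cast hm
    linarith) T
  have hp : ((m : ℝ) - 1) ^ T = (1 + -(1 / m : ℝ)) ^ T * (m : ℝ) ^ T := by
    rw [← mul_pow]; congr 1; field_simp; ring
  have hmT : (0 : ℝ) < (m : ℝ) ^ T := by positivity
  have := mul_le_mul_of_nonneg_right hb hmT.le
  rw [← hp] at this
  have e : (1 + (T : ℝ) * -(1 / m)) * (m : ℝ) ^ T = (m : ℝ) ^ T - T / m * (m : ℝ) ^ T := by ring
  linarith

theorem abs_meanRun_le (hm : 0 < m) {S : Fin m → Z} {h : Θ → ℝ} {B : ℝ}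
    (hB : ∀ θ, |h θ| ≤ B) : |meanRun G θ₀ T S h| ≤ B := by
  have hmT : (0 : ℝ) < (m : ℝ) ^ T := by positivity
  rw [meanRun, abs_div, abs_of_pos hmT, div_le_iff₀ hmT]
  refine (Finset.abs_sum_le_sum_abs _ _).trans
    ((Finset.sum_le_sum fun σ _ => hB _).trans (le_of_eq ?_))
  simp [mul_comm]

theorem meanRun_nonneg {S : Fin m → Z} {h : Θ → ℝ} (h0 : ∀ θ, 0 ≤ h θ) :
    0 ≤ meanRun G θ₀ T S h :=
  div_nonneg (Finset.sum_nonneg fun _ _ => h0 _) (by positivity)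

/-- **Uniform stability** of the random iteration: replacing one training example changes the
mean of a function of oscillation at most `B` by at most `T * B / m`. -/
theorem abs_meanRun_update_sub_le {S : Fin m → Z} {h : Θ → ℝ} {B : ℝ}
    (hB : ∀ θ θ', |h θ - h θ'| ≤ B) (i : Fin m) (z : Z) :
    |meanRun G θ₀ T (Function.update S i z) h - meanRun G θ₀ T S h| ≤ T * B / m := by
  have hm : 0 < m := i.pos
  have hmT : (0 : ℝ) < (m : ℝ) ^ T := by positivity
  have hB0 : 0 ≤ B := (abs_nonneg _).trans (hB θ₀ θ₀)
  rw [meanRun, meanRun, ← sub_div, ← Finset.sum_sub_distrib, abs_div, abs_of_pos hmT,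
    div_le_iff₀ hmT]
  calc _ ≤ ∑ σ : Fin T → Fin m,
        |h (iterRun G θ₀ (Function.update S i z) σ) - h (iterRun G θ₀ S σ)| :=
        Finset.abs_sum_le_sum_abs _ _
    _ ≤ ∑ σ : Fin T → Fin m, if ∃ t, σ t = i then B else 0 := by
        refine Finset.sum_le_sum fun σ _ => ?_
        split_ifs with hσ
        · exact hB _ _
        · rw [iterRun_update z (by simpa using hσ)]; simp
    _ = (Finset.univ.filter fun σ : Fin T → Fin m => ∃ t, σ t = i).card * B := by
        rw [← Finset.sum_filter]; simp
    _ ≤ T / m * (m : ℝ) ^ T * B := by gcongr; exact card_visit_le i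
    _ = T * B / m * (m : ℝ) ^ T := by ring

variable [MeasurableSpace Z]

/-- The expected difference between the risk and the empirical risk for the loss `F`. -/
def meanGap (F : Θ → Z → ℝ) (G : Θ → Z → Θ) (θ₀ : Θ) (T : ℕ) (P : Measure Z)
    (S : Fin m → Z) : ℝ :=
  meanRun G θ₀ T S (fun θ => ∫ z, F θ z ∂P)
    - (∑ k, meanRun G θ₀ T S (fun θ => F θ (S k))) / m

variable {F : Θ → Z → ℝ} {M B : ℝ} {P : Measure Z} [IsProbabilityMeasure P]

theorem abs_risk_le (hM : ∀ θ z, 0 ≤ F θ z ∧ F θ z ≤ M) (θ : Θ) : |∫ z, F θ z ∂P| ≤ M := by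
  have := norm_integral_le_of_norm_le_const (μ := P) (f := F θ) (C := M)
    (Eventually.of_forall fun z => by
      rw [Real.norm_eq_abs, abs_of_nonneg (hM θ z).1]; exact (hM θ z).2)
  simpa using this

theorem abs_meanGap_le (hm : 0 < m) (hM : ∀ θ z, 0 ≤ F θ z ∧ F θ z ≤ M) (S : Fin m → Z) :
    |meanGap F G θ₀ T P S| ≤ M + M := by
  have hm' : (0 : ℝ) < m := by exact_mod_cast hm
  refine (abs_sub _ _).trans (add_le_add (abs_meanRun_le hm (abs_risk_le hM)) ?_)
  rw [abs_div, abs_of_pos hm', div_le_iff₀ hm']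
  refine (Finset.abs_sum_le_sum_abs _ _).trans
    ((Finset.sum_le_sum fun k _ => abs_meanRun_le hm (B := M) fun θ => ?_).trans (le_of_eq ?_))
  · rw [abs_of_nonneg (hM θ _).1]; exact (hM θ _).2
  · simp [mul_comm]

variable [MeasurableSpace Θ]

theorem measurable_iterRun (hG : Measurable (Function.uncurry G)) (σ : Fin T → Fin m) :
    Measurable fun S : Fin m → Z => iterRun G θ₀ S σ := by
  -- The initial state is generalized to a measurable function of `S`, because after one step the
  -- state depends on the sample.
  suffices ∀ (l : List (Fin m)) (f : (Fin m → Z) → Θ), Measurable f →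
      Measurable fun S : Fin m → Z => l.foldl (fun θ i => G θ (S i)) (f S) from
    this _ _ measurable_const
  intro l
  induction l with
  | nil => exact fun f hf => hf
  | cons i l ih =>
    exact fun f hf => ih (fun S => G (f S) (S i)) (hG.comp (hf.prodMk (measurable_pi_apply i)))

theorem measurable_meanRun {X : Type*} [MeasurableSpace X] (hG : Measurable (Function.uncurry G))
    {h : X → Θ → ℝ} (hh : Measurable (Function.uncurry h)) {s : X → Fin m → Z}
    (hs : Measurable s) : Measurable fun x => meanRun G θ₀ T (s x) (h x) := by
  refine (Finset.measurable_sum _ fun σ _ => ?_).div_const _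
  exact hh.comp (measurable_id.prodMk ((measurable_iterRun hG σ).comp hs))

theorem abs_integral_sub_le (hF : Measurable (Function.uncurry F))
    (hM : ∀ θ z, 0 ≤ F θ z ∧ F θ z ≤ M) (hB : ∀ θ θ' z, |F θ z - F θ' z| ≤ B) (θ θ' : Θ) :
    |(∫ z, F θ z ∂P) - ∫ z, F θ' z ∂P| ≤ B := by
  have hi : ∀ θ, Integrable (F θ) P := fun θ =>
    .of_bound (hF.comp (measurable_const.prodMk measurable_id)).aestronglyMeasurable M
      (Eventually.of_forall fun z => by
        rw [Real.norm_eq_abs, abs_of_nonneg (hM θ z).1]; exact (hM θ z).2)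
  rw [← integral_sub (hi θ) (hi θ')]
  have := norm_integral_le_of_norm_le_const (μ := P) (f := fun z => F θ z - F θ' z)
    (Eventually.of_forall fun z => hB θ θ' z)
  simpa using this

/-- Stability is paid once for the risk and once for the empirical risk. The replaced example adds
at most `M / m`, since its loss is evaluated at a different point and only the range `[0, M]` is
available there. -/
theorem abs_meanGap_update_sub_le (hF : Measurable (Function.uncurry F))
    (hM : ∀ θ z, 0 ≤ F θ z ∧ F θ z ≤ M) (hB : ∀ θ θ' z, |F θ z - F θ' z| ≤ B)
    (S : Fin m → Z) (i : Fin m) (z : Z) :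
    |meanGap F G θ₀ T P (Function.update S i z) - meanGap F G θ₀ T P S|
      ≤ (2 * T * B + M) / m := by
  have hm : 0 < m := i.pos
  have hm' : (0 : ℝ) < m := by exact_mod_cast hm
  have h1 := abs_meanRun_update_sub_le (G := G) (θ₀ := θ₀) (T := T) (S := S)
    (abs_integral_sub_le (P := P) hF hM hB) i z
  have hβ : 0 ≤ T * B / m := (abs_nonneg _).trans h1
  have h2 : ∀ k, |meanRun G θ₀ T (Function.update S i z)
        (fun θ => F θ (Function.update S i z k)) - meanRun G θ₀ T S (fun θ => F θ (S k))|
      ≤ T * B / m + if k = i then M else 0 := fun k => by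
    split_ifs with hk
    · have hab : ∀ (S : Fin m → Z) w, 0 ≤ meanRun G θ₀ T S (fun θ => F θ w) ∧
          meanRun G θ₀ T S (fun θ => F θ w) ≤ M := fun S w =>
        ⟨meanRun_nonneg fun θ => (hM θ w).1, (le_abs_self _).trans (abs_meanRun_le hm fun θ => by
          rw [abs_of_nonneg (hM θ w).1]; exact (hM θ w).2)⟩
      have ha := hab (Function.update S i z) (Function.update S i z k)
      have hb := hab S (S k)
      rw [abs_le]
      constructor <;> linarith
    · rw [Function.update_of_ne hk, add_zero]
      exact abs_meanRun_update_sub_le (fun θ θ' => hB θ θ' (S k)) i z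
  have h3 : |(∑ k, meanRun G θ₀ T (Function.update S i z)
        (fun θ => F θ (Function.update S i z k))) / m
      - (∑ k, meanRun G θ₀ T S (fun θ => F θ (S k))) / m| ≤ T * B / m + M / m := by
    rw [← sub_div, ← Finset.sum_sub_distrib, abs_div, abs_of_pos hm', div_le_iff₀ hm']
    refine (Finset.abs_sum_le_sum_abs _ _).trans
      ((Finset.sum_le_sum fun k _ => h2 k).trans (le_of_eq ?_))
    rw [Finset.sum_add_distrib]
    simp
    field_simp
  have e : (2 * T * B + M) / m = T * B / m + (T * B / m + M / m) := by ring
  rw [e, meanGap, meanGap, sub_sub_sub_comm]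
  exact (abs_sub _ _).trans (add_le_add h1 h3)

theorem measurable_risk (hF : Measurable (Function.uncurry F)) :
    Measurable fun θ => ∫ z, F θ z ∂P :=
  hF.stronglyMeasurable.integral_prod_right.measurable

theorem measurable_meanRun_coord (hF : Measurable (Function.uncurry F))
    (hG : Measurable (Function.uncurry G)) (k : Fin m) :
    Measurable fun S : Fin m → Z => meanRun G θ₀ T S (fun θ => F θ (S k)) := by
  refine measurable_meanRun hG (h := fun S θ => F θ (S k)) ?_ measurable_id
  exact hF.comp (measurable_snd.prodMk ((measurable_pi_apply k).comp measurable_fst))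

theorem measurable_meanRun_risk (hF : Measurable (Function.uncurry F))
    (hG : Measurable (Function.uncurry G)) :
    Measurable fun S : Fin m → Z => meanRun G θ₀ T S (fun θ => ∫ z, F θ z ∂P) :=
  measurable_meanRun hG (h := fun _ θ => ∫ z, F θ z ∂P)
    ((measurable_risk hF).comp measurable_snd) measurable_id

theorem measurable_meanGap (hF : Measurable (Function.uncurry F))
    (hG : Measurable (Function.uncurry G)) :
    Measurable (meanGap (m := m) F G θ₀ T P) :=
  (measurable_meanRun_risk hF hG).sub
    ((Finset.measurable_sum _ fun k _ => measurable_meanRun_coord hF hG k).div_const _)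

/-- Stability bounds the generalization gap in expectation over the sample. -/
theorem integral_meanGap_le (hm : 0 < m) (hF : Measurable (Function.uncurry F))
    (hG : Measurable (Function.uncurry G))
    (hM : ∀ θ z, 0 ≤ F θ z ∧ F θ z ≤ M) (hB : ∀ θ θ' z, |F θ z - F θ' z| ≤ B) :
    ∫ S, meanGap F G θ₀ T P S ∂(Measure.pi fun _ : Fin m => P) ≤ T * B / m := by
  have hm' : (0 : ℝ) < m := by exact_mod_cast hm
  set μ := Measure.pi fun _ : Fin m => P
  have hFM : ∀ θ z, |F θ z| ≤ M := fun θ z => by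
    rw [abs_of_nonneg (hM θ z).1]; exact (hM θ z).2
  have hi1 : Integrable (fun S : Fin m → Z => meanRun G θ₀ T S (fun θ => ∫ z, F θ z ∂P)) μ :=
    .of_bound (measurable_meanRun_risk hF hG).aestronglyMeasurable M
      (Eventually.of_forall fun S => abs_meanRun_le hm (abs_risk_le hM))
  have hi2 : ∀ k, Integrable (fun S : Fin m → Z => meanRun G θ₀ T S (fun θ => F θ (S k))) μ :=
    fun k => .of_bound (measurable_meanRun_coord hF hG k).aestronglyMeasurable M
      (Eventually.of_forall fun S => abs_meanRun_le hm fun θ => hFM θ _)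
  have hi3 : Integrable
      (fun p : (Fin m → Z) × Z => meanRun G θ₀ T p.1 (fun θ => F θ p.2)) (μ.prod P) :=
    .of_bound (measurable_meanRun hG (h := fun (p : (Fin m → Z) × Z) θ => F θ p.2)
        (hF.comp (measurable_snd.prodMk (measurable_snd.comp measurable_fst)))
        measurable_fst).aestronglyMeasurable M
      (Eventually.of_forall fun S => abs_meanRun_le hm fun θ => hFM θ _)
  -- The risk is the loss at a fresh point `p.2`, independent of the sample.
  have hrisk : ∫ S, meanRun G θ₀ T S (fun θ => ∫ z, F θ z ∂P) ∂μ
      = ∫ p, meanRun G θ₀ T p.1 (fun θ => F θ p.2) ∂(μ.prod P) := by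
    rw [integral_prod _ hi3]
    refine integral_congr_ae (Eventually.of_forall fun S => ?_)
    simp only [meanRun]
    rw [integral_div, integral_finsetSum]
    exact fun σ _ => .of_bound
      (hF.comp (measurable_const.prodMk measurable_id)).aestronglyMeasurable M
      (Eventually.of_forall fun z => hFM _ z)
  -- Putting the fresh point in slot `k` preserves the law of the sample, turning the loss at a
  -- training point into the loss at `p.2` after a run on the updated sample. Stability compares
  -- this with the run on the original sample.
  have hk : ∀ k, ∫ S, meanRun G θ₀ T S (fun θ => ∫ z, F θ z ∂P) ∂μ - T * B / m
      ≤ ∫ S, meanRun G θ₀ T S (fun θ => F θ (S k)) ∂μ := fun k => by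
    have hp := measurePreserving_update (P := P) k
    have hi4 := (hp.integrable_comp (hi2 k).aestronglyMeasurable).2 (hi2 k)
    have : ∫ S, meanRun G θ₀ T S (fun θ => F θ (S k)) ∂μ
        = ∫ p, meanRun G θ₀ T (Function.update p.1 k p.2)
            (fun θ => F θ (Function.update p.1 k p.2 k)) ∂(μ.prod P) := by
      have h := hp.map_eq
      rw [← integral_map hp.measurable.aemeasurable
        (f := fun S : Fin m → Z => meanRun G θ₀ T S (fun θ => F θ (S k)))
        (by rw [h]; exact (hi2 k).aestronglyMeasurable), h]
    rw [this, hrisk]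
    have hc : ∫ _ : (Fin m → Z) × Z, (T * B / m : ℝ) ∂(μ.prod P) = T * B / m := by simp
    rw [← hc, ← integral_sub hi3 (integrable_const _)]
    refine integral_mono (hi3.sub (integrable_const _)) hi4 fun p => ?_
    have := abs_le.1 (abs_meanRun_update_sub_le (G := G) (θ₀ := θ₀) (T := T) (S := p.1)
      (fun θ θ' => hB θ θ' p.2) k p.2)
    simp only [Function.update_self]
    linarith [this.1]
  simp only [meanGap]
  rw [integral_sub hi1 ((integrable_finsetSum _ fun k _ => hi2 k).div_const _), integral_div,
    integral_finsetSum _ fun k _ => hi2 k, sub_le_comm, le_div_iff₀ hm']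
  refine le_trans (le_of_eq ?_) (Finset.sum_le_sum fun k _ => hk k)
  rw [Finset.sum_const, Finset.card_univ, Fintype.card_fin, nsmul_eq_mul, mul_comm]

/-- **Generalization by stability**: for a loss with values in `[0, M]` whose dependence on the
state is bounded by `B`, the mean generalization gap of the random iteration is small with high
probability. -/
theorem le_measure_meanGap_le (hm : 0 < m) (hF : Measurable (Function.uncurry F))
    (hG : Measurable (Function.uncurry G)) (hM0 : 0 ≤ M)
    (hM : ∀ θ z, 0 ≤ F θ z ∧ F θ z ≤ M) (hB0 : 0 ≤ B) (hB : ∀ θ θ' z, |F θ z - F θ' z| ≤ B)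
    {δ : ℝ} (hδ : 0 < δ) (hδ1 : δ < 1) :
    ENNReal.ofReal (1 - δ) ≤ (Measure.pi fun _ : Fin m => P)
      {S | meanGap F G θ₀ T P S ≤
        T * B / m + (2 * T * B + M) * Real.sqrt (Real.log (1 / δ) / (2 * m))} := by
  have hm' : (0 : ℝ) < m := by exact_mod_cast hm
  set μ := Measure.pi fun _ : Fin m => P
  set ε := (2 * T * B + M) * Real.sqrt (Real.log (1 / δ) / (2 * m)) with hε
  have hlog : 0 ≤ Real.log (1 / δ) := Real.log_nonneg (by rw [le_div_iff₀ hδ]; linarith)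
  -- For `M = 0` the loss vanishes identically; this case is split off because the difference
  -- constant could then be zero, making the exponent degenerate.
  rcases hM0.eq_or_lt with rfl | hM0
  · have hF0 : ∀ θ z, F θ z = 0 := fun θ z => le_antisymm (hM θ z).2 (hM θ z).1
    have hall : {S : Fin m → Z | meanGap F G θ₀ T P S ≤ T * B / m + ε} = Set.univ := by
      refine Set.eq_univ_of_forall fun S => ?_
      have : meanGap F G θ₀ T P S = 0 := by simp [meanGap, meanRun, hF0]
      rw [Set.mem_ofPred_eq, this]
      positivity
    rw [hall, measure_univ]
    exact ENNReal.ofReal_le_one.2 (by linarith)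
  have hK : 0 < 2 * T * B + M := by positivity
  have hmeas := measurable_meanGap (m := m) (θ₀ := θ₀) (T := T) (P := P) hF hG
  have hgood : MeasurableSet {S | meanGap F G θ₀ T P S ≤ T * B / m + ε} :=
    measurableSet_le hmeas measurable_const
  let c : ℝ≥0 := ⟨(2 * T * B + M) / m, by positivity⟩
  have hMc := measureReal_ge_le_of_boundedDifferences (P := P) (c := c) hmeas
    (abs_meanGap_le hm hM) (abs_meanGap_update_sub_le hF hM hB) (ε := ε) (by positivity)
  -- `ε` is chosen so that the McDiarmid tail equals `δ` exactly.
  have hexp : Real.exp (-ε ^ 2 / (2 * (m * ((c : ℝ) / 2) ^ 2))) = δ := by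
    have hc : (c : ℝ) = (2 * T * B + M) / m := rfl
    have : -ε ^ 2 / (2 * (m * ((c : ℝ) / 2) ^ 2)) = -Real.log (1 / δ) := by
      rw [hc, hε, mul_pow, Real.sq_sqrt (by positivity)]
      field_simp
    rw [this, Real.log_div one_ne_zero hδ.ne', Real.log_one, zero_sub, neg_neg, Real.exp_log hδ]
  rw [hexp] at hMc
  have hbad : μ.real {S | meanGap F G θ₀ T P S ≤ T * B / m + ε}ᶜ ≤ δ := by
    refine (measureReal_mono fun S hS => ?_).trans hMc
    simp only [Set.mem_compl_iff, Set.mem_ofPred_eq, not_le] at hS ⊢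
    linarith [integral_meanGap_le (θ₀ := θ₀) (T := T) (P := P) hm hF hG hM hB]
  rw [← ENNReal.ofReal_toReal (measure_ne_top μ _)]
  refine ENNReal.ofReal_le_ofReal ?_
  have := probReal_compl_eq_one_sub (μ := μ) hgood
  change _ ≤ μ.real _
  linarith

end Stability

end QNN

end

noncomputable section

namespace QNN

/-! ### Rotation gates: unitarity and smoothness -/

section Gates

variable {N : ℕ}

theorem pauliOn_conjTranspose (q : Fin N) (p : Pauli) :
    (pauliOn q p).conjTranspose = pauliOn q p := by
  have hP : p.toMatrix.conjTranspose = p.toMatrix := by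
    cases p <;> ext i j <;> fin_cases i <;> fin_cases j <;> simp [Pauli.toMatrix]
  ext a b
  simp only [Matrix.conjTranspose_apply, pauliOn, Matrix.of_apply, star_prod]
  refine Finset.prod_congr rfl fun k _ => ?_
  rw [← Matrix.conjTranspose_apply]
  split_ifs
  · rw [hP]
  · rw [Matrix.conjTranspose_one]

/-- The exponent is skew-Hermitian because Pauli matrices are Hermitian, so the adjoint of its
exponential is the inverse. -/
theorem rotation_mem_unitary (q : Fin N) (p : Pauli) (α : ℝ) :
    rotation q p α ∈ Matrix.unitaryGroup (Basis N) ℂ := by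
  have hx : ((-(Complex.I * (α : ℂ) / 2)) • pauliOn q p).conjTranspose
      = -((-(Complex.I * (α : ℂ) / 2)) • pauliOn q p) := by
    rw [Matrix.conjTranspose_smul, pauliOn_conjTranspose, ← neg_smul]
    congr 1
    simp
    ring
  rw [Matrix.mem_unitaryGroup_iff', Matrix.star_eq_conjTranspose, rotation,
    ← Matrix.exp_conjTranspose, hx]
  rw [← Matrix.exp_add_of_commute (-((-(Complex.I * (α : ℂ) / 2)) • pauliOn q p)) _
    (Commute.refl ((-(Complex.I * (α : ℂ) / 2)) • pauliOn q p)).neg_left,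
    neg_add_cancel, NormedSpace.exp_zero]

attribute [local instance] Matrix.linftyOpNormedRing Matrix.linftyOpNormedAlgebra

/-- The exponential is differentiated along the complex line through the generator and then
restricted to real angles. The local norm on matrices only supplies the normed algebra structure
this requires. -/
theorem differentiable_rotation_apply (q : Fin N) (p : Pauli) (a b : Basis N) :
    Differentiable ℝ fun α : ℝ => rotation q p α a b := by
  have h1 : Differentiable ℂ fun u : ℂ => NormedSpace.exp (u • pauliOn q p) := fun u =>
    (hasDerivAt_exp_smul_const (pauliOn q p) u).differentiableAt
  let e : Op N →L[ℂ] ℂ := LinearMap.toContinuousLinearMap (Matrix.entryLinearMap ℂ ℂ a b)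
  have h2 : Differentiable ℂ fun u : ℂ => NormedSpace.exp (u • pauliOn q p) a b :=
    e.differentiable.comp h1
  have h3 : Differentiable ℝ fun α : ℝ => (-(Complex.I * (α : ℂ) / 2)) := by
    have : Differentiable ℝ fun α : ℝ => (α : ℂ) := Complex.ofRealCLM.differentiable
    fun_prop
  exact (h2.restrictScalars ℝ).comp h3

end Gates

/-! ### Regularity of the output via function algebras -/

section Entries

variable {X : Type*} {N : ℕ}

/-- All matrix entries of the operator-valued function `F` lie in the function algebra `A`. -/
def EntriesIn (A : Subalgebra ℂ (X → ℂ)) (F : X → Op N) : Prop :=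
  ∀ a b, (fun p => F p a b) ∈ A

variable {A : Subalgebra ℂ (X → ℂ)} {F G : X → Op N}

theorem EntriesIn.const (M : Op N) : EntriesIn A fun _ => M := fun a b =>
  A.algebraMap_mem (M a b)

theorem EntriesIn.mul (hF : EntriesIn A F) (hG : EntriesIn A G) :
    EntriesIn A fun p => F p * G p := fun a b => by
  have : (fun p => (F p * G p) a b)
      = ∑ c, (fun p => F p a c) * (fun p => G p c b) := by
    ext p; simp [Matrix.mul_apply]
  rw [this]
  exact sum_mem fun c _ => mul_mem (hF a c) (hG c b)

theorem EntriesIn.list_prod {l : List (X → Op N)} (h : ∀ F ∈ l, EntriesIn A F) :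
    EntriesIn A fun p => (l.map fun F => F p).prod := by
  induction l with
  | nil => exact EntriesIn.const 1
  | cons F l ih =>
    simp only [List.map_cons, List.prod_cons]
    exact (h F (by simp)).mul (ih fun G hG => h G (by simp [hG]))

theorem EntriesIn.trace (hF : EntriesIn A F) : (fun p => (F p).trace) ∈ A := by
  have : (fun p => (F p).trace) = ∑ a, fun p => F p a a := by
    ext p; simp [Matrix.trace]
  rw [this]
  exact sum_mem fun a _ => hF a a

theorem EntriesIn.conjTranspose (hstar : ∀ f ∈ A, star f ∈ A) (hF : EntriesIn A F) :
    EntriesIn A fun p => (F p).conjTranspose := fun a b => hstar _ (hF b a)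

variable {L D : ℕ} {n : Fin (L + 1) → ℕ} (Q : ReuploadingQNN N L D n)

theorem entriesIn_toOp {k : ℕ} (W : TrainableBlock N k) {α : X → Fin k → ℝ}
    (h : ∀ i, EntriesIn A fun p => rotation (W.qubit i) (W.axis i) (α p i)) :
    EntriesIn A fun p => W.toOp (α p) := by
  have := EntriesIn.list_prod (A := A) (l := List.ofFn fun i : Fin k => fun p =>
      (W.gate i : Op N) * rotation (W.qubit i) (W.axis i) (α p i)) (by
    intro F hF
    obtain ⟨i, rfl⟩ := (List.mem_ofFn' _ _).1 hF
    exact (EntriesIn.const _).mul (h i))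
  simp only [List.map_ofFn, Function.comp_def] at this
  exact this.mul (EntriesIn.const _)

theorem entriesIn_circuit {θ : X → Params n} {x : X → Fin D → ℝ}
    (hθ : ∀ j (q : Fin N) p, EntriesIn A fun s => rotation q p (θ s j))
    (hx : EntriesIn A fun s => (Q.encode (x s) : Op N)) :
    EntriesIn A fun s => Q.circuit (θ s) (x s) := by
  have hb : ∀ l, EntriesIn A fun s => Q.blockOp (θ s) l := fun l =>
    entriesIn_toOp (Q.block l) fun i => hθ _ _ _
  have := EntriesIn.list_prod (A := A) (l := (List.ofFn fun l : Fin L => fun s =>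
      Q.blockOp (θ s) l.succ * (Q.encode (x s) : Op N)).reverse) (by
    intro F hF
    obtain ⟨i, rfl⟩ := (List.mem_ofFn' _ _).1 (List.mem_reverse.1 hF)
    exact (hb _).mul hx)
  simp only [List.map_reverse, List.map_ofFn, Function.comp_def] at this
  exact this.mul (hb 0)

/-- The trace is a polynomial in the entries of the rotations and the encoder and in their
conjugates. Any conjugation-closed function algebra containing those entries therefore contains it;
the algebras of measurable and of real-differentiable functions give the two regularity statements
needed for training. -/
theorem output_mem (hstar : ∀ f ∈ A, star f ∈ A) {θ : X → Params n} {x : X → Fin D → ℝ}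
    (hθ : ∀ j (q : Fin N) p, EntriesIn A fun s => rotation q p (θ s j))
    (hx : EntriesIn A fun s => (Q.encode (x s) : Op N)) :
    ∃ f ∈ A, ∀ s, Q.output (θ s) (x s) = (f s).re := by
  have hc := entriesIn_circuit Q hθ hx
  exact ⟨_, ((EntriesIn.const Q.obs).mul ((hc.mul (EntriesIn.const Q.rho)).mul
    (hc.conjTranspose hstar))).trace, fun s => rfl⟩

theorem measurable_output :
    Measurable fun p : Params n × (Fin D → ℝ) => Q.output p.1 p.2 := by
  let A : Subalgebra ℂ (Params n × (Fin D → ℝ) → ℂ) :=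
    { carrier := {f | Measurable f}
      mul_mem' := fun hf hg => Measurable.mul hf hg
      add_mem' := fun hf hg => Measurable.add hf hg
      algebraMap_mem' := fun c => measurable_const }
  obtain ⟨f, hf, hfo⟩ := output_mem Q (A := A)
    (fun f hf => (Complex.continuous_conj.measurable.comp hf : Measurable fun p => star (f p)))
    (θ := Prod.fst) (x := Prod.snd)
    (fun j q p a b => ((differentiable_rotation_apply q p a b).continuous.measurable.comp
      ((measurable_pi_apply j).comp measurable_fst)))
    (fun a b => (Q.encode_measurable a b).comp measurable_snd)
  simp_rw [hfo]
  exact Complex.measurable_re.comp hf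

theorem differentiable_output_update (θ : Params n) (j : Σ l : Fin (L + 1), Fin (n l))
    (x : Fin D → ℝ) : Differentiable ℝ fun s : ℝ => Q.output (Function.update θ j s) x := by
  let A : Subalgebra ℂ (ℝ → ℂ) :=
    { carrier := {f | Differentiable ℝ f}
      mul_mem' := fun hf hg => Differentiable.mul hf hg
      add_mem' := fun hf hg => Differentiable.add hf hg
      algebraMap_mem' := fun c => differentiable_const _ }
  obtain ⟨f, hf, hfo⟩ := output_mem Q (A := A)
    (fun f hf => (Complex.conjCLE.differentiable.comp hf : Differentiable ℝ fun p => star (f p)))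
    (θ := fun s => Function.update θ j s) (x := fun _ => x)
    (fun i q p a b => by
      have hi : Differentiable ℝ fun s : ℝ => Function.update θ j s i := by
        by_cases h : i = j
        · subst h; simp
        · simp [h]
      exact (differentiable_rotation_apply q p a b).comp hi)
    (EntriesIn.const _)
  simp_rw [hfo]
  exact Complex.reCLM.differentiable.comp hf

end Entries

/-! ### Bound on the network output by the norm of the observable -/

section OutputBound

variable {N L D : ℕ} {n : Fin (L + 1) → ℕ} (Q : ReuploadingQNN N L D n)

theorem toOp_mem_unitary {k : ℕ} (W : TrainableBlock N k) (α : Fin k → ℝ) :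
    W.toOp α ∈ Matrix.unitaryGroup (Basis N) ℂ := by
  refine mul_mem (list_prod_mem fun U hU => ?_) W.last.2
  obtain ⟨i, rfl⟩ := (List.mem_ofFn' _ _).1 hU
  exact mul_mem (W.gate i).2 (rotation_mem_unitary _ _ _)

theorem circuit_mem_unitary (θ : Params n) (x : Fin D → ℝ) :
    Q.circuit θ x ∈ Matrix.unitaryGroup (Basis N) ℂ := by
  refine mul_mem (list_prod_mem fun U hU => ?_) (toOp_mem_unitary _ _)
  obtain ⟨i, rfl⟩ := (List.mem_ofFn' _ _).1 (List.mem_reverse.1 hU)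
  exact mul_mem (toOp_mem_unitary _ _) (Q.encode x).2

theorem opNorm_nonneg (A : Op N) : 0 ≤ opNorm A := norm_nonneg _

theorem norm_star_dotProduct_mulVec_le (A : Op N) (v : Basis N → ℂ) :
    ‖star v ⬝ᵥ A.mulVec v‖ ≤ opNorm A * ∑ a, ‖v a‖ ^ 2 := by
  set w : EuclideanSpace ℂ (Basis N) := WithLp.toLp 2 v with hw
  have h1 : star v ⬝ᵥ A.mulVec v
      = inner ℂ w (Matrix.toEuclideanCLM (n := Basis N) (𝕜 := ℂ) A w) := by
    rw [hw, Matrix.toEuclideanCLM_toLp, EuclideanSpace.inner_toLp_toLp, dotProduct_comm]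
  have h2 : ∑ a, ‖v a‖ ^ 2 = ‖w‖ ^ 2 := by rw [EuclideanSpace.norm_sq_eq]
  rw [h1, h2, opNorm]
  refine (norm_inner_le_norm _ _).trans ?_
  calc _ ≤ ‖w‖ * (‖Matrix.toEuclideanCLM (n := Basis N) (𝕜 := ℂ) A‖ * ‖w‖) := by
        gcongr; exact ContinuousLinearMap.le_opNorm _ _
    _ = _ := by ring

/-- Duality between the operator norm and the trace norm, on positive semidefinite matrices. -/
theorem norm_trace_mul_le (A : Op N) {R : Op N} (hR : R.PosSemidef) :
    ‖(A * R).trace‖ ≤ opNorm A * R.trace.re := by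
  obtain ⟨C, rfl⟩ : ∃ C : Op N, R = C.conjTranspose * C := by
    open scoped MatrixOrder Matrix.Norms.L2Operator in
    exact CStarAlgebra.nonneg_iff_eq_star_mul_self.mp hR.nonneg
  -- The trace is a sum of quadratic forms of `A` at the conjugated rows of `C`, whose squared norms
  -- add up to the trace of `R`.
  have h1 : (A * (C.conjTranspose * C)).trace
      = ∑ i, star (fun a => star (C i a)) ⬝ᵥ A.mulVec fun a => star (C i a) := by
    rw [← mul_assoc, Matrix.trace_mul_comm]
    simp [Matrix.trace, Matrix.mul_apply, dotProduct, Matrix.mulVec]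
  have h2 : (C.conjTranspose * C).trace.re = ∑ i, ∑ a, ‖star (C i a)‖ ^ 2 := by
    rw [Matrix.trace_mul_comm]
    simp [Matrix.trace, Matrix.mul_apply, Complex.mul_conj, Complex.normSq_eq_norm_sq,
      -Complex.ofReal_pow]
  rw [h1, h2, Finset.mul_sum]
  exact (norm_sum_le _ _).trans
    (Finset.sum_le_sum fun i _ => norm_star_dotProduct_mulVec_le A fun a => star (C i a))

/-- Conjugation by the unitary circuit keeps the input state positive semidefinite of trace one, so
trace duality applies with constant `1`. -/
theorem abs_output_le (θ : Params n) (x : Fin D → ℝ) : |Q.output θ x| ≤ opNorm Q.obs := by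
  have hU := Matrix.mem_unitaryGroup_iff'.1 (circuit_mem_unitary Q θ x)
  have htr : (Q.circuit θ x * Q.rho * (Q.circuit θ x).conjTranspose).trace = 1 := by
    rw [Matrix.trace_mul_comm, ← mul_assoc, ← Matrix.star_eq_conjTranspose, hU, one_mul,
      Q.rho_trace]
  have h := norm_trace_mul_le Q.obs (Q.rho_posSemidef.mul_mul_conjTranspose_same (Q.circuit θ x))
  rw [htr, Complex.one_re, mul_one] at h
  exact (Complex.abs_re_le_norm _).trans h

end OutputBound

end QNN

end

noncomputable section

namespace QNN

/-! ### Gradient training as a measurable random iteration -/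

section Training

variable {N L D : ℕ} {n : Fin (L + 1) → ℕ} (Q : ReuploadingQNN N L D n)

/-- The partial derivative is the pointwise limit of jointly measurable difference quotients with
increments `1 / (k + 1)`. No continuity in the data variable is required. -/
theorem measurable_deriv_update {J X : Type*} [MeasurableSpace X] [DecidableEq J]
    {F : (J → ℝ) → X → ℝ} (hF : Measurable (Function.uncurry F)) (j : J)
    (hd : ∀ θ x, Differentiable ℝ fun s => F (Function.update θ j s) x) :
    Measurable fun p : (J → ℝ) × X => deriv (fun s => F (Function.update p.1 j s) p.2) (p.1 j) := by
  let h : ℕ → ℝ := fun k => 1 / ((k : ℝ) + 1)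
  have hh : Tendsto h atTop (nhdsWithin 0 {0}ᶜ) :=
    tendsto_nhdsWithin_iff.2 ⟨tendsto_one_div_add_atTop_nhds_zero_nat,
      Eventually.of_forall fun k => (Nat.one_div_pos_of_nat (n := k)).ne'⟩
  have hu : ∀ t : ℝ, Measurable fun p : (J → ℝ) × X => F (Function.update p.1 j (p.1 j + t)) p.2 := by
    intro t
    have hi : ∀ i, Measurable fun p : (J → ℝ) × X => p.1 i := fun i =>
      (measurable_pi_apply i).comp measurable_fst
    have hup : ∀ i, Measurable fun p : (J → ℝ) × X =>
        Function.update p.1 j (p.1 j + t) i := fun i => by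
      by_cases hij : i = j
      · subst hij; simpa only [Function.update_self] using (hi i).add_const t
      · simpa only [Function.update_of_ne hij] using hi i
    exact hF.comp ((measurable_pi_lambda _ hup).prodMk measurable_snd)
  refine measurable_of_tendsto_metrizable
    (f := fun k p => (h k)⁻¹ * (F (Function.update p.1 j (p.1 j + h k)) p.2
      - F (Function.update p.1 j (p.1 j + 0)) p.2))
    (fun k => ((hu (h k)).sub (hu 0)).const_mul _) (tendsto_pi_nhds.2 fun p => ?_)
  have := ((hd p.1 p.2 (p.1 j)).hasDerivAt.tendsto_slope_zero).comp hh
  simpa [Function.comp_def] using this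

theorem measurable_lossAt {ℓ : ℝ → ℝ → ℝ} (hℓ : Measurable (Function.uncurry ℓ)) :
    Measurable (Function.uncurry (Q.lossAt ℓ)) := by
  have h1 : Measurable fun p : Params n × ((Fin D → ℝ) × ℝ) => (p.1, p.2.1) :=
    measurable_fst.prodMk (measurable_fst.comp measurable_snd)
  have h0 := measurable_output Q
  have h2 := h0.comp h1
  have h3 : Measurable fun p : Params n × ((Fin D → ℝ) × ℝ) => p.2.2 :=
      measurable_snd.comp measurable_snd
  have h4 := hℓ.comp (h2.prodMk h3)
  simpa only [Function.comp_def, Function.uncurry_def, ReuploadingQNN.lossAt] using h4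

/-- The training bound for a loss that is regular for all labels. -/
theorem le_measure_expectedGap_le {ℓ : ℝ → ℝ → ℝ} {I : Set ℝ} {C₁ : ℝ≥0} {M : ℝ}
    (hI : ∀ θ x, Q.output θ x ∈ I) (hℓ : Measurable (Function.uncurry ℓ))
    (hlip : ∀ y, LipschitzOnWith C₁ (fun a => ℓ a y) I)
    (hdiff : ∀ y, DifferentiableOn ℝ (fun a => ℓ a y) I)
    (hbdd : ∀ y, ∀ a ∈ I, 0 ≤ ℓ a y ∧ ℓ a y ≤ M)
    (P : Measure ((Fin D → ℝ) × ℝ)) [IsProbabilityMeasure P] (η : ℝ) (T : ℕ) (θ₀ : Params n)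
    {m : ℕ} (hm : 0 < m) {δ : ℝ} (hδ : 0 < δ) (hδ1 : δ < 1) :
    ENNReal.ofReal (1 - δ) ≤ (Measure.pi fun _ : Fin m => P)
      {S | Q.expectedGap ℓ P η T θ₀ S ≤ T * (2 * C₁ * opNorm Q.obs) / m
        + (2 * T * (2 * C₁ * opNorm Q.obs) + M)
          * Real.sqrt (Real.log (1 / δ) / (2 * m))} := by
  have hF := measurable_lossAt Q hℓ
  have hd : ∀ j θ z, Differentiable ℝ fun s => Q.lossAt ℓ (Function.update θ j s) z := by
    intro j θ z
    have := (hdiff z.2).comp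
      (differentiable_output_update Q θ j z.1).differentiableOn (s := Set.univ)
      (fun s _ => hI _ _)
    exact differentiableOn_univ.1 this
  have hG : Measurable (Function.uncurry (Q.sgdStep ℓ η)) := by
    refine measurable_pi_lambda _ fun j => ?_
    exact ((measurable_pi_apply j).comp measurable_fst).sub
      ((measurable_deriv_update hF j (hd j)).const_mul η)
  have hM : ∀ θ z, 0 ≤ Q.lossAt ℓ θ z ∧ Q.lossAt ℓ θ z ≤ M := fun θ z => hbdd _ _ (hI _ _)
  have hM0 : 0 ≤ M := (hM θ₀ 0).1.trans (hM θ₀ 0).2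
  have hB : ∀ θ θ' z, |Q.lossAt ℓ θ z - Q.lossAt ℓ θ' z| ≤ 2 * C₁ * opNorm Q.obs := by
    intro θ θ' z
    have h1 := (hlip z.2).dist_le_mul _ (hI θ z.1) _ (hI θ' z.1)
    rw [Real.dist_eq, Real.dist_eq] at h1
    have h2 : |Q.output θ z.1 - Q.output θ' z.1| ≤ opNorm Q.obs + opNorm Q.obs :=
      (abs_sub _ _).trans (add_le_add (abs_output_le Q _ _) (abs_output_le Q _ _))
    refine h1.trans ((mul_le_mul_of_nonneg_left h2 C₁.coe_nonneg).trans (le_of_eq ?_))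
    ring
  have hgap : ∀ S : Fin m → (Fin D → ℝ) × ℝ,
      Q.expectedGap ℓ P η T θ₀ S = meanGap (Q.lossAt ℓ) (Q.sgdStep ℓ η) θ₀ T P S := by
    intro S
    simp only [meanGap, meanRun, ReuploadingQNN.expectedGap, Finset.sum_sub_distrib, sub_div]
    congr 1
    simp only [ReuploadingQNN.empiricalRisk, ← Finset.sum_div]
    rw [Finset.sum_comm, div_right_comm]
    rfl
  simp_rw [hgap]
  exact le_measure_meanGap_le hm hF hG hM0 hM (by have := opNorm_nonneg Q.obs; positivity) hB hδ hδ1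

/-- Training, risk and empirical risk see only labels in `Y`, up to a null set for the risk. This
allows the loss to be redefined at all other labels. -/
theorem expectedGap_congr {ℓ ℓ' : ℝ → ℝ → ℝ} {Y : Set ℝ} (h : ∀ a, ∀ y ∈ Y, ℓ a y = ℓ' a y)
    {P : Measure ((Fin D → ℝ) × ℝ)} (hP : ∀ᵐ z ∂P, z.2 ∈ Y) (η : ℝ) (T : ℕ) (θ₀ : Params n)
    {m : ℕ} {S : Fin m → (Fin D → ℝ) × ℝ} (hS : ∀ i, (S i).2 ∈ Y) :
    Q.expectedGap ℓ P η T θ₀ S = Q.expectedGap ℓ' P η T θ₀ S := by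
  have hl : ∀ θ z, z.2 ∈ Y → Q.lossAt ℓ θ z = Q.lossAt ℓ' θ z := fun θ z hz => h _ _ hz
  have hlS : ∀ θ i, Q.lossAt ℓ θ (S i) = Q.lossAt ℓ' θ (S i) := fun θ i => hl θ _ (hS i)
  have hrun : ∀ σ : Fin T → Fin m, Q.sgdRun ℓ η θ₀ S σ = Q.sgdRun ℓ' η θ₀ S σ := fun σ => by
    refine List.foldl_ext _ _ _ fun θ i _ => ?_
    funext j
    simp only [ReuploadingQNN.sgdStep, hlS]
  have hrisk : ∀ θ, Q.risk ℓ P θ = Q.risk ℓ' P θ := fun θ =>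
    integral_congr_ae (hP.mono fun z hz => hl θ z hz)
  have hemp : ∀ θ, Q.empiricalRisk ℓ S θ = Q.empiricalRisk ℓ' S θ := fun θ => by
    simp only [ReuploadingQNN.empiricalRisk, hlS]
  simp only [ReuploadingQNN.expectedGap, hrun, hrisk, hemp]

/-- The single threshold `u ≥ 2` works for every exponent, as `T ≤ 2 ^ T ≤ u ^ T`; the filter `⊤` on
`ℕ` expresses this uniformity. -/
theorem isBigO_const_mul_pow (C : ℝ) :
    (fun p : ℕ × ℝ => C * (p.1 : ℝ)) =O[(⊤ : Filter ℕ) ×ˢ (atTop : Filter ℝ)]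
      fun p : ℕ × ℝ => p.2 ^ p.1 := by
  refine IsBigO.of_bound |C| ?_
  filter_upwards [tendsto_snd.eventually (eventually_ge_atTop (2 : ℝ))] with p hp
  rw [norm_mul, Real.norm_eq_abs, norm_pow]
  gcongr
  calc ‖(p.1 : ℝ)‖ = (p.1 : ℝ) := by simp
    _ ≤ (2 : ℝ) ^ p.1 := by exact_mod_cast (Nat.lt_two_pow_self).le
    _ ≤ ‖p.2‖ ^ p.1 := by gcongr; exact hp.trans (le_abs_self _)

end Training

end QNN

end

/-- The rate obtained here is `g T u = 4 * C₁ * T`: a given training example is visited within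
`T` steps with probability at most `T / m`, and the loss varies by at most `2 * C₁ * ‖ℳ‖`, so the
training is uniformly stable with the constant `2 * C₁ * ‖ℳ‖ * T / m`. -/
theorem corollary1 (C₁ C₂ : ℝ≥0) :
    ∃ g : ℕ → ℝ → ℝ,
      ((fun p : ℕ × ℝ => g p.1 p.2) =O[(⊤ : Filter ℕ) ×ˢ (atTop : Filter ℝ)]
        fun p : ℕ × ℝ => p.2 ^ p.1) ∧
      ∀ (N L D : ℕ) (n : Fin (L + 1) → ℕ) (Q : QNN.ReuploadingQNN N L D n)
        (ℓ : ℝ → ℝ → ℝ) (I Y : Set ℝ) (M : ℝ)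
        (P : Measure ((Fin D → ℝ) × ℝ)) (η : ℝ) (T : ℕ) (θ₀ : QNN.Params n) (m : ℕ) (δ : ℝ),
        1 ≤ L → 1 ≤ D → 1 ≤ m → 0 < η → 0 < δ → δ < 1 →
        IsProbabilityMeasure P →
        I.OrdConnected → (∀ θ x, Q.output θ x ∈ I) →
        MeasurableSet Y → (∀ᵐ z ∂P, z.2 ∈ Y) →
        Measurable (Function.uncurry ℓ) →
        QNN.LipschitzSmoothBounded ℓ I Y C₁ C₂ M →
        ENNReal.ofReal (1 - δ) ≤
          (Measure.pi fun _ : Fin m => P)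
            {S | Q.expectedGap ℓ P η T θ₀ S ≤
              (L * D * QNN.opNorm Q.obs) / m
                  * g T (η * QNN.numParams n * QNN.opNorm Q.obs)
                + (L * D * QNN.opNorm Q.obs * g T (η * QNN.numParams n * QNN.opNorm Q.obs) + M)
                  * Real.sqrt (Real.log (1 / δ) / (2 * m))} := by
  -- The fluctuation term dictates the constant: it contains twice the stability constant, `2 * T *
  -- (2 * C₁ * ‖ℳ‖)`, while the mean term needs only half of that.
  refine ⟨fun T _ => 4 * C₁ * T, QNN.isBigO_const_mul_pow _, ?_⟩
  intro N L D n Q ℓ I Y M P η T θ₀ m δ hL hD hm _ hδ hδ1 _ _ hI hY hPY hℓ h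
  obtain ⟨z₀, hz₀⟩ := hPY.exists
  have hM0 : 0 ≤ M := (h.bounded _ hz₀ _ (hI θ₀ z₀.1)).1.trans (h.bounded _ hz₀ _ (hI θ₀ z₀.1)).2
  -- Extending the loss by zero outside `Y` makes it regular for every label and keeps it
  -- measurable.
  let ℓ' : ℝ → ℝ → ℝ := fun a => Y.indicator (ℓ a)
  have hin : ∀ y ∈ Y, (fun a => ℓ' a y) = fun a => ℓ a y := fun y hy =>
    funext fun a => Set.indicator_of_mem hy _
  have hout : ∀ y ∉ Y, (fun a => ℓ' a y) = fun _ => 0 := fun y hy =>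
    funext fun a => Set.indicator_of_notMem hy _
  have hℓ' : Measurable (Function.uncurry ℓ') := by
    have : Function.uncurry ℓ' = (Prod.snd ⁻¹' Y).indicator (Function.uncurry ℓ) := rfl
    rw [this]
    exact hℓ.indicator (measurable_snd hY)
  have key := QNN.le_measure_expectedGap_le Q (ℓ := ℓ') (C₁ := C₁) (M := M) hI hℓ'
    (fun y => by
      by_cases hy : y ∈ Y
      · rw [hin y hy]; exact h.lipschitz y hy
      · rw [hout y hy]; exact (LipschitzWith.const' 0).lipschitzOnWith)
    (fun y => by
      by_cases hy : y ∈ Y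
      · rw [hin y hy]; exact h.differentiable y hy
      · rw [hout y hy]; exact differentiableOn_const _)
    (fun y a ha => by
      by_cases hy : y ∈ Y
      · rw [congrFun (hin y hy) a]; exact h.bounded y hy a ha
      · rw [congrFun (hout y hy) a]; exact ⟨le_rfl, hM0⟩)
    P η T θ₀ hm hδ hδ1
  -- The two gaps agree only for samples with all labels in `Y`, hence the almost-everywhere
  -- comparison of events.
  refine key.trans (measure_mono_ae ?_)
  have hSY : ∀ᵐ S ∂(Measure.pi fun _ : Fin m => P), ∀ i, (S i).2 ∈ Y :=
    ae_all_iff.2 fun i => (Measure.quasiMeasurePreserving_eval (fun _ => P) i).ae hPY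
  filter_upwards [hSY] with S hS hgap
  have hO := QNN.opNorm_nonneg Q.obs
  have hLD : (1 : ℝ) ≤ L * D := by exact_mod_cast Nat.mul_pos hL hD
  have hb : 4 * C₁ * T * QNN.opNorm Q.obs
      ≤ L * D * QNN.opNorm Q.obs * (4 * C₁ * T) := by
    have : 0 ≤ 4 * (C₁ : ℝ) * T * QNN.opNorm Q.obs := by positivity
    nlinarith [mul_le_mul_of_nonneg_right hLD this]
  have hb' : T * (2 * C₁ * QNN.opNorm Q.obs) ≤ L * D * QNN.opNorm Q.obs * (4 * C₁ * T) := by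
    refine le_trans ?_ hb
    have : 0 ≤ (C₁ : ℝ) * T * QNN.opNorm Q.obs := by positivity
    linarith
  change Q.expectedGap ℓ P η T θ₀ S ≤ _
  rw [QNN.expectedGap_congr Q (ℓ' := ℓ') (fun a y hy => (congrFun (hin y hy) a).symm) hPY η T θ₀ hS]
  refine le_trans hgap ?_
  rw [div_mul_eq_mul_div]
  exact add_le_add (div_le_div_of_nonneg_right hb' (by positivity))
    (mul_le_mul_of_nonneg_right (by linarith) (Real.sqrt_nonneg _))
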